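/- Fix $L>0$. Call a function $V:\mathbb R^d\to\mathbb R$ convex and $L$-smooth if it is convex, continuously differentiable, and $\|\nabla V(x)-\nabla V(y)\|\le L\|x-y\|$ for all $x,y\in\mathbb R^d$ (Euclidean norm). An $s$-stage Runge--Kutta (RK) scheme with coefficients $a_{ij}$ and weights $b_j$, applied with step $h$ to $\frac{d}{dt}x=F(x)$, takes $x_0$ to $x_1=x_0+h\sum_{j}b_jF(X_j)$, where the stages satisfy $X_i=x_0+h\sum_j a_{ij}F(X_j)$, $i=1,\dots,s$. An interval $(0,h_c]$ with $h_c=h_c(L)>0$ is an interval of convex contractivity of an RK scheme if, for every $h\in(0,h_c]$, every $d$, every convex and $L$-smooth $V$ on $\mathbb R^d$ and any two initial points $x_0,\widetilde x_0\in\mathbb R^d$, the results $x_1,\widetilde x_1$ of one step of the scheme with step $h$ for the gradient system $\frac{d}{dt}x=-\nabla V(x)$ satisfy $\|\widetilde x_1-x_1\|\le\|\widetilde x_0-x_0\|$. Consider Runge's explicit second-order method $$y_1=y_0+hF\Big(y_0+\frac h2F(y_0)\Big),$$ that is, the two-stage RK scheme with $a_{21}=\frac12$, $a_{11}=a_{12}=a_{22}=0$,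 $b_1=0$, $b_2=1$. For every $h>0$ there exist a convex and $L$-smooth potential $V$ on $\mathbb R^2$ and initial points $x_0,\widetilde x_0\in\mathbb R^2$ such that one step of this method with $F=-\nabla V$ gives $$\|\widetilde x_1-x_1\|>\|\widetilde x_0-x_0\|.$$ As a consequence, the method has no interval of convex contractivity. -/

import Mathlib

/-- `V` is convex, continuously differentiable, and its gradient is globally Lipschitz
continuous with constant `L`. -/
structure IsConvexLSmooth {d : ℕ} (L : ℝ) (V : EuclideanSpace ℝ (Fin d) → ℝ) : Prop where
  convex : ConvexOn ℝ Set.univ V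
  contDiff : ContDiff ℝ 1 V
  lipschitz_gradient : ∀ x y, ‖gradient V x - gradient V y‖ ≤ L * ‖x - y‖

/-- An `s`-stage Runge-Kutta scheme, given by its coefficients `a i j` and weights `b j`. -/
structure RKScheme (s : ℕ) where
  a : Fin s → Fin s → ℝ
  b : Fin s → ℝ

/-- `x₁` is obtained from `x₀` by one step of length `h` of the scheme, applied to
`dx/dt = F x`; the `X i` are the stage vectors. -/
def RKScheme.IsStep {s d : ℕ} (S : RKScheme s) (h : ℝ)
    (F : EuclideanSpace ℝ (Fin d) → EuclideanSpace ℝ (Fin d))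
    (x₀ x₁ : EuclideanSpace ℝ (Fin d)) : Prop :=
  ∃ X : Fin s → EuclideanSpace ℝ (Fin d),
    (∀ i, X i = x₀ + h • ∑ j, S.a i j • F (X j)) ∧
      x₁ = x₀ + h • ∑ j, S.b j • F (X j)

/-- `(0, hc]` is an interval of convex contractivity of the scheme, for the Lipschitz constant
`L`: in every dimension, for every `h ∈ (0, hc]` and every convex `L`-smooth potential `V`, one
step of length `h` for `dx/dt = -∇V(x)` does not increase the distance of any two points. -/
def RKScheme.IsIntervalOfConvexContractivity {s : ℕ} (S : RKScheme s) (L hc : ℝ) : Prop :=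
  0 < hc ∧ ∀ h ∈ Set.Ioc 0 hc, ∀ (d : ℕ) (V : EuclideanSpace ℝ (Fin d) → ℝ),
    IsConvexLSmooth L V → ∀ x₀ y₀ x₁ y₁ : EuclideanSpace ℝ (Fin d),
      S.IsStep h (fun x => -gradient V x) x₀ x₁ → S.IsStep h (fun x => -gradient V x) y₀ y₁ →
        ‖y₁ - x₁‖ ≤ ‖y₀ - x₀‖

/-- One step of Runge's explicit second-order method. -/
noncomputable def rungeStep {d : ℕ} (h : ℝ)
    (F : EuclideanSpace ℝ (Fin d) → EuclideanSpace ℝ (Fin d))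
    (y₀ : EuclideanSpace ℝ (Fin d)) : EuclideanSpace ℝ (Fin d) :=
  y₀ + h • F (y₀ + (h / 2) • F y₀)

/-- Runge's explicit second-order method as a two-stage Runge-Kutta scheme. -/
noncomputable def rungeScheme : RKScheme 2 where
  a := ![![0, 0], ![1 / 2, 0]]
  b := ![0, 1]

/-- A step of the two-stage scheme is a step of Runge's method in its explicit form. -/
theorem rungeScheme_isStep_iff {d : ℕ} (h : ℝ)
    (F : EuclideanSpace ℝ (Fin d) → EuclideanSpace ℝ (Fin d))
    (x₀ x₁ : EuclideanSpace ℝ (Fin d)) :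
    rungeScheme.IsStep h F x₀ x₁ ↔ x₁ = rungeStep h F x₀ := by
  constructor
  · rintro ⟨X, hX, hx⟩
    have h0 : X 0 = x₀ := by simpa [rungeScheme] using hX 0
    have h1 : X 1 = x₀ + (h / 2) • F x₀ := by
      have := hX 1
      simpa [rungeScheme, Fin.sum_univ_two, h0, smul_smul, div_eq_mul_inv] using this
    simpa [rungeScheme, Fin.sum_univ_two, h1, rungeStep] using hx
  · rintro rfl
    refine ⟨![x₀, x₀ + (h / 2) • F x₀], ?_, ?_⟩
    · intro i
      fin_cases i <;> simp [rungeScheme, Fin.sum_univ_two, smul_smul, div_eq_mul_inv]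
    · simp [rungeScheme, Fin.sum_univ_two, rungeStep]

/-!
On a half-space where the Hessian of the potential is `M` at the first stages and `N` at the
second stages, one step of Runge's method sends a difference `w` of initial points to
`w - h • N (w - (h / 2) • M w)`. The matrices `M` and `N` need not commute: for an orthonormal
pair `e`, `f`, take `N = c • e eᵀ` and `M = c • (e + f) (e + f)ᵀ + N`. Then `N f = 0` and
`N M f = c ^ 2 • e`, so that `f` becomes `f + ((h * c) ^ 2 / 2) • e`, which is longer than `f`.
The potential that switches from `M` to `N` is
`c / 2 * max ⟪e + f, x⟫ 0 ^ 2 + c / 2 * ⟪e, x⟫ ^ 2`; starting far enough in the direction of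
`e - f`, the first half step crosses the hyperplane on which the Hessian jumps.
-/

open scoped RealInnerProductSpace

section InnerProductSpace

variable {E : Type*} [NormedAddCommGroup E] [InnerProductSpace ℝ E]

theorem norm_lt_norm_add_of_inner_eq_zero {x y : E} (hx : x ≠ 0) (hxy : ⟪x, y⟫ = 0) :
    ‖y‖ < ‖x + y‖ := by
  have hpos : 0 < ‖x‖ := norm_pos_iff.2 hx
  nlinarith [norm_add_sq_eq_norm_sq_add_norm_sq_real hxy, norm_nonneg (x + y)]

variable [CompleteSpace E]

theorem hasGradientAt_add {V W : E → ℝ} {v w x : E} (hV : HasGradientAt V v x)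
    (hW : HasGradientAt W w x) : HasGradientAt (V + W) (v + w) x := by
  rw [hasGradientAt_iff_hasFDerivAt, map_add]
  exact hV.hasFDerivAt.add hW.hasFDerivAt

theorem hasGradientAt_comp_inner {φ : ℝ → ℝ} {φ' : ℝ} {u x : E}
    (hφ : HasDerivAt φ φ' ⟪u, x⟫) : HasGradientAt (fun y => φ ⟪u, y⟫) (φ' • u) x := by
  rw [hasGradientAt_iff_hasFDerivAt, map_smulₛₗ]
  exact hφ.comp_hasFDerivAt x (innerSL ℝ u).hasFDerivAt

end InnerProductSpace

namespace IsConvexLSmooth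

variable {d : ℕ}

theorem hasGradientAt {L : ℝ} {V : EuclideanSpace ℝ (Fin d) → ℝ} (hV : IsConvexLSmooth L V)
    (x : EuclideanSpace ℝ (Fin d)) : HasGradientAt V (gradient V x) x :=
  (hV.contDiff.differentiable one_ne_zero x).hasGradientAt

theorem add {K L : ℝ} {V W : EuclideanSpace ℝ (Fin d) → ℝ} (hV : IsConvexLSmooth K V)
    (hW : IsConvexLSmooth L W) : IsConvexLSmooth (K + L) (V + W) where
  convex := hV.convex.add hW.convex
  contDiff := hV.contDiff.add hW.contDiff
  lipschitz_gradient x y := by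
    have hgrad : gradient (V + W) = gradient V + gradient W :=
      gradient_eq fun z => hasGradientAt_add (hV.hasGradientAt z) (hW.hasGradientAt z)
    calc ‖gradient (V + W) x - gradient (V + W) y‖
        = ‖(gradient V x - gradient V y) + (gradient W x - gradient W y)‖ := by
          simp only [hgrad, Pi.add_apply, add_sub_add_comm]
      _ ≤ K * ‖x - y‖ + L * ‖x - y‖ :=
          norm_add_le_of_le (hV.lipschitz_gradient x y) (hW.lipschitz_gradient x y)
      _ = (K + L) * ‖x - y‖ := (add_mul _ _ _).symm

theorem comp_inner {φ φ' : ℝ → ℝ} {K : ℝ} (hφ : ∀ t, HasDerivAt φ (φ' t) t)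
    (hmono : Monotone φ') (hlip : ∀ s t, |φ' s - φ' t| ≤ K * |s - t|)
    (u : EuclideanSpace ℝ (Fin d)) : IsConvexLSmooth (K * ‖u‖ ^ 2) (fun x => φ ⟪u, x⟫) where
  convex := by
    have hderiv : deriv φ = φ' := funext fun t => (hφ t).deriv
    exact (Monotone.convexOn_univ_of_deriv (fun t => (hφ t).differentiableAt)
      (hderiv ▸ hmono)).comp_linearMap (innerₛₗ ℝ u)
  contDiff := by
    have hcont : Continuous φ' := (LipschitzWith.of_dist_le' (K := K) hlip).continuous
    have hderiv : deriv φ = φ' := funext fun t => (hφ t).deriv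
    exact (contDiff_one_iff_deriv.2 ⟨fun t => (hφ t).differentiableAt, hderiv ▸ hcont⟩).comp
      (innerSL ℝ u).contDiff
  lipschitz_gradient x y := by
    have hK : 0 ≤ K := by simpa using (abs_nonneg _).trans (hlip 1 0)
    have hgrad : gradient (fun z => φ ⟪u, z⟫) = fun z => φ' ⟪u, z⟫ • u :=
      gradient_eq fun z => hasGradientAt_comp_inner (hφ _)
    calc ‖gradient (fun z => φ ⟪u, z⟫) x - gradient (fun z => φ ⟪u, z⟫) y‖
        = |φ' ⟪u, x⟫ - φ' ⟪u, y⟫| * ‖u‖ := by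
          simp only [hgrad, ← sub_smul, norm_smul, Real.norm_eq_abs]
      _ ≤ K * |⟪u, x⟫ - ⟪u, y⟫| * ‖u‖ := by gcongr; exact hlip _ _
      _ ≤ K * (‖u‖ * ‖x - y‖) * ‖u‖ := by
          rw [← inner_sub_right]
          gcongr
          exact abs_real_inner_le_norm _ _
      _ = K * ‖u‖ ^ 2 * ‖x - y‖ := by ring

end IsConvexLSmooth

theorem max_zero_sq_sub_tangent_mem_Icc (s t : ℝ) :
    max t 0 ^ 2 - max s 0 ^ 2 - 2 * max s 0 * (t - s) ∈ Set.Icc 0 ((t - s) ^ 2) := by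
  rcases max_cases s 0 with ⟨h, h'⟩ | ⟨h, h'⟩ <;> rcases max_cases t 0 with ⟨k, k'⟩ | ⟨k, k'⟩ <;>
    rw [h, k] <;> constructor <;> nlinarith [sq_nonneg (t - s)]

theorem hasDerivAt_max_zero_sq (s : ℝ) : HasDerivAt (fun t => max t 0 ^ 2) (2 * max s 0) s := by
  rw [hasDerivAt_iff_isLittleO]
  refine Asymptotics.IsBigO.trans_isLittleO (g := fun t => ‖t - s‖ ^ 2) ?_
    (Asymptotics.isLittleO_pow_sub_sub s one_lt_two)
  refine Asymptotics.IsBigO.of_norm_le fun t => ?_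
  obtain ⟨hnonneg, hle⟩ := max_zero_sq_sub_tangent_mem_Icc s t
  rw [smul_eq_mul, mul_comm (t - s), Real.norm_of_nonneg hnonneg, Real.norm_eq_abs, sq_abs]
  exact hle

theorem hasDerivAt_half_mul_max_zero_sq (c t : ℝ) :
    HasDerivAt (fun s => c / 2 * max s 0 ^ 2) (c * max t 0) t :=
  ((hasDerivAt_max_zero_sq t).const_mul (c / 2)).congr_deriv (by ring)

theorem hasDerivAt_half_mul_sq (c t : ℝ) : HasDerivAt (fun s => c / 2 * s ^ 2) (c * t) t :=
  ((hasDerivAt_pow 2 t).const_mul (c / 2)).congr_deriv (by ring)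

section KinkedQuadratic

variable {E : Type*} [NormedAddCommGroup E] [InnerProductSpace ℝ E]

/-- The piecewise quadratic potential whose Hessian is `c • (u uᵀ + v vᵀ)` on the half-space
`0 < ⟪u, x⟫` and `c • v vᵀ` on the half-space `⟪u, x⟫ < 0`. It supplies the counterexample, where
`u` and `v` are neither parallel nor orthogonal, so that the two Hessians do not commute. -/
noncomputable def kinkedQuadratic (c : ℝ) (u v x : E) : ℝ :=
  c / 2 * max ⟪u, x⟫ 0 ^ 2 + c / 2 * ⟪v, x⟫ ^ 2

variable [CompleteSpace E]

theorem gradient_kinkedQuadratic (c : ℝ) (u v : E) :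
    gradient (kinkedQuadratic c u v) = fun x => (c * max ⟪u, x⟫ 0) • u + (c * ⟪v, x⟫) • v :=
  gradient_eq fun _ => hasGradientAt_add
    (hasGradientAt_comp_inner (hasDerivAt_half_mul_max_zero_sq c _))
    (hasGradientAt_comp_inner (hasDerivAt_half_mul_sq c _))

theorem gradient_kinkedQuadratic_add_self {e f : E} (he : ‖e‖ = 1) (hf : ‖f‖ = 1)
    (hef : ⟪e, f⟫ = 0) (c p q : ℝ) : gradient (kinkedQuadratic c (e + f) e) (p • e + q • f) =
      (c * max (p + q) 0) • (e + f) + (c * p) • e := by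
  have he_inner : ⟪e, p • e + q • f⟫ = p := by
    simp only [inner_add_right, real_inner_smul_right, real_inner_self_eq_norm_sq, he, hef]
    ring
  have hf_inner : ⟪f, p • e + q • f⟫ = q := by
    simp only [inner_add_right, real_inner_smul_right, real_inner_self_eq_norm_sq, hf,
      real_inner_comm, hef]
    ring
  simp only [gradient_kinkedQuadratic, inner_add_left, he_inner, hf_inner]

end KinkedQuadratic

theorem isConvexLSmooth_kinkedQuadratic {d : ℕ} {c : ℝ} (hc : 0 ≤ c)
    (u v : EuclideanSpace ℝ (Fin d)) :
    IsConvexLSmooth (c * ‖u‖ ^ 2 + c * ‖v‖ ^ 2) (kinkedQuadratic c u v) := by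
  refine (IsConvexLSmooth.comp_inner (hasDerivAt_half_mul_max_zero_sq c) ?_ ?_ u).add
    (IsConvexLSmooth.comp_inner (hasDerivAt_half_mul_sq c) ?_ ?_ v)
  · exact (monotone_id.max monotone_const).const_mul hc
  · intro s t
    rw [← mul_sub, abs_mul, abs_of_nonneg hc]
    exact mul_le_mul_of_nonneg_left (abs_max_sub_max_le_abs s t 0) hc
  · exact monotone_id.const_mul hc
  · intro s t
    rw [← mul_sub, abs_mul, abs_of_nonneg hc]

section OrthonormalPair

variable {d : ℕ} {e f : EuclideanSpace ℝ (Fin d)}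

theorem rungeStep_kinkedQuadratic (he : ‖e‖ = 1) (hf : ‖f‖ = 1) (hef : ⟪e, f⟫ = 0)
    {c h p q : ℝ} (hfirst : 0 ≤ p + q) (hsecond : p + q ≤ h * c / 2 * (2 * (p + q) + p)) :
    rungeStep h (fun x => -gradient (kinkedQuadratic c (e + f) e) x) (p • e + q • f) =
      (p - h * c * (p - h * c / 2 * (p + q + p))) • e + q • f := by
  have hstage : p • e + q • f +
      (h / 2) • -gradient (kinkedQuadratic c (e + f) e) (p • e + q • f) =
        (p - h * c / 2 * (p + q + p)) • e + (q - h * c / 2 * (p + q)) • f := by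
    rw [gradient_kinkedQuadratic_add_self he hf hef, max_eq_left hfirst]
    module
  have hcross : p - h * c / 2 * (p + q + p) + (q - h * c / 2 * (p + q)) ≤ 0 := by linarith
  rw [rungeStep, hstage, gradient_kinkedQuadratic_add_self he hf hef, max_eq_right hcross]
  module

theorem norm_sub_lt_norm_rungeStep_kinkedQuadratic_sub (he : ‖e‖ = 1) (hf : ‖f‖ = 1)
    (hef : ⟪e, f⟫ = 0) {c h a : ℝ} (hhc : 0 < h * c) (ha : h * c * a = 2) :
    ‖(a • e + (1 - a) • f) - (a • e + (-a) • f)‖ <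
      ‖rungeStep h (fun x => -gradient (kinkedQuadratic c (e + f) e) x) (a • e + (1 - a) • f) -
        rungeStep h (fun x => -gradient (kinkedQuadratic c (e + f) e) x) (a • e + (-a) • f)‖ := by
  rw [rungeStep_kinkedQuadratic he hf hef (by linarith) (by linarith),
    rungeStep_kinkedQuadratic he hf hef (by linarith) (by linarith)]
  have hbefore : (a • e + (1 - a) • f) - (a • e + (-a) • f) = f := by module
  have hafter : (a - h * c * (a - h * c / 2 * (a + (1 - a) + a))) • e + (1 - a) • f -
      ((a - h * c * (a - h * c / 2 * (a + -a + a))) • e + (-a) • f) =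
        ((h * c) ^ 2 / 2) • e + f := by module
  rw [hbefore, hafter]
  have he_ne : e ≠ 0 := norm_ne_zero_iff.1 (he ▸ one_ne_zero)
  exact norm_lt_norm_add_of_inner_eq_zero (smul_ne_zero (by positivity) he_ne)
    (by rw [real_inner_smul_left, hef, mul_zero])

end OrthonormalPair

theorem exists_norm_sub_lt_norm_rungeStep_sub {d : ℕ} (hd : 2 ≤ d) {L h : ℝ} (hL : 0 < L)
    (hh : 0 < h) : ∃ (V : EuclideanSpace ℝ (Fin d) → ℝ) (x₀ y₀ : EuclideanSpace ℝ (Fin d)),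
      IsConvexLSmooth L V ∧
        ‖y₀ - x₀‖ < ‖rungeStep h (fun x => -gradient V x) y₀ -
          rungeStep h (fun x => -gradient V x) x₀‖ := by
  obtain ⟨e, f, he, hf, hef⟩ :
      ∃ e f : EuclideanSpace ℝ (Fin d), ‖e‖ = 1 ∧ ‖f‖ = 1 ∧ ⟪e, f⟫ = 0 := by
    have horth := (EuclideanSpace.basisFun (Fin d) ℝ).orthonormal
    exact ⟨_, _, horth.1 ⟨0, by lia⟩, horth.1 ⟨1, by lia⟩, horth.2 (by simp)⟩
  have hsmooth := isConvexLSmooth_kinkedQuadratic (c := L / 3) (by positivity) (e + f) e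
  have hconst : L / 3 * ‖e + f‖ ^ 2 + L / 3 * ‖e‖ ^ 2 = L := by
    rw [norm_add_sq_real, he, hf, hef]
    ring
  exact ⟨_, _, _, hconst ▸ hsmooth, norm_sub_lt_norm_rungeStep_kinkedQuadratic_sub he hf hef
    (by positivity) (mul_div_cancel₀ 2 (by positivity))⟩

theorem not_isIntervalOfConvexContractivity_rungeScheme {L : ℝ} (hL : 0 < L) (hc : ℝ) :
    ¬ rungeScheme.IsIntervalOfConvexContractivity L hc := by
  rintro ⟨hpos, hcontr⟩
  obtain ⟨V, x₀, y₀, hV, hlt⟩ := exists_norm_sub_lt_norm_rungeStep_sub le_rfl hL hpos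
  exact hlt.not_ge (hcontr hc ⟨hpos, le_rfl⟩ 2 V hV x₀ y₀ _ _
    ((rungeScheme_isStep_iff _ _ _ _).2 rfl) ((rungeScheme_isStep_iff _ _ _ _).2 rfl))

theorem theorem3_general {d : ℕ} (hd : 2 ≤ d) {L : ℝ} (hL : 0 < L) :
    (∀ h : ℝ, 0 < h → ∃ (V : EuclideanSpace ℝ (Fin d) → ℝ) (x₀ y₀ : EuclideanSpace ℝ (Fin d)),
      IsConvexLSmooth L V ∧
        ‖y₀ - x₀‖ < ‖rungeStep h (fun x => -gradient V x) y₀ -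
          rungeStep h (fun x => -gradient V x) x₀‖) ∧
    ¬ ∃ hc : ℝ, rungeScheme.IsIntervalOfConvexContractivity L hc :=
  ⟨fun _ => exists_norm_sub_lt_norm_rungeStep_sub hd hL,
    fun ⟨hc, h⟩ => not_isIntervalOfConvexContractivity_rungeScheme hL hc h⟩

theorem theorem3 (L : ℝ) (hL : 0 < L) :
    (∀ h : ℝ, 0 < h → ∃ (V : EuclideanSpace ℝ (Fin 2) → ℝ) (x₀ y₀ : EuclideanSpace ℝ (Fin 2)),
      IsConvexLSmooth L V ∧
        ‖y₀ - x₀‖ < ‖rungeStep h (fun x => -gradient V x) y₀ -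
          rungeStep h (fun x => -gradient V x) x₀‖) ∧
    ¬ ∃ hc : ℝ, rungeScheme.IsIntervalOfConvexContractivity L hc :=
  theorem3_general le_rfl hL
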